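/- Let $n\ge 1$ be an integer, let $\lambda$ be the Lebesgue area measure on $\mathbb{C}$, and let $d\mu(z)=\frac{e^{-|z|^2}}{\pi}\,d\lambda(z)$. Let $$K_n(z,w)=L^1_{n-1}(|z-w|^2)\,e^{z\overline{w}},\qquad L^1_{n-1}(x)=\sum_{j=0}^{n-1}\binom{n}{n-1-j}\frac{(-x)^j}{j!},$$ be the kernel of the $n$-analytic Fock space on $\mathbb{C}$, and let $k_z^n(w)=K_n(w,z)/\sqrt{K_n(z,z)}$ be the normalized kernel. For $f\in L^\infty(\mathbb{C})=L^\infty(\mathbb{C},d\lambda)$ (complex-valued), the polyanalytic Berezin transform of $f$ is $$B_nf(z)=\langle f k_z^n,k_z^n\rangle_{L^2(\mu)}=\int_{\mathbb{C}} f(w)\,|k_z^n(w)|^2\,d\mu(w),\qquad z\in\mathbb{C}.$$ Then, for every $f\in L^\infty(\mathbb{C})$, the following conditions are equivalent: (i) $B_nf=f$; (ii) $f$ is harmonic on $\mathbb{C}$; (iii) $f$ is constant. Here, as usual in $L^\infty(\mathbb{C})$, functions that agree $\lambda$-almost everywhere are identified: (i) is equality almost everywhere, (ii) means that $f$ agrees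 almost everywhere with a harmonic function on $\mathbb{C}$, and (iii) that $f$ agrees almost everywhere with a constant. -/

import Mathlib

noncomputable section

namespace PolyFock

open MeasureTheory ComplexConjugate

/-- The generalized Laguerre polynomial
`L^β_k(x) = ∑_{j=0}^k (k+β choose k-j) (-x)^j / j!`, for a natural number `β`. -/
def laguerre (β k : ℕ) (x : ℝ) : ℝ :=
  ∑ j ∈ Finset.range (k + 1),
    ((k + β).choose (k - j) : ℝ) * (-x) ^ j / (j.factorial : ℝ)

/-- The Gaussian probability measure `dμ(z) = e^{-|z|²} / π dλ(z)` on `ℂ`. -/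
def gaussian : Measure ℂ :=
  (volume : Measure ℂ).withDensity
    (fun z => ENNReal.ofReal (Real.exp (-‖z‖ ^ 2) / Real.pi))

/-- The inner product `⟨g, h⟩ = ∫ g h̄ dμ` of `L²(ℂ, dμ)`. -/
def innerGaussian (g h : ℂ → ℂ) : ℂ :=
  ∫ w, g w * conj (h w) ∂gaussian

/-- The kernel `K_n(z, w) = L^1_{n-1}(|z - w|²) e^{z w̄}` of the `n`-analytic Fock space, `n ≥ 1`. -/
def kernel (n : ℕ) (z w : ℂ) : ℂ :=
  (laguerre 1 (n - 1) (‖z - w‖ ^ 2) : ℂ) * Complex.exp (z * conj w)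

/-- The normalized kernel `k_z^n(w) = K_n(w, z) / √K_n(z, z)`.
The number `K_n(z, z) = n e^{|z|²}` is real and positive for `n ≥ 1`,
so its square root is that of its real part. -/
def normalizedKernel (n : ℕ) (z : ℂ) : ℂ → ℂ :=
  fun w => kernel n w z / (Real.sqrt (kernel n z z).re : ℂ)

/-- The polyanalytic Berezin transform `B_n f(z) = ⟨f k_z^n, k_z^n⟩`. -/
def berezin (n : ℕ) (f : ℂ → ℂ) (z : ℂ) : ℂ :=
  innerGaussian (fun w => f w * normalizedKernel n z w) (normalizedKernel n z)

end PolyFock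

end

open MeasureTheory Filter Topology ComplexConjugate

namespace PolyFock

/-! The factor `e^{z w̄}` and the Gaussian weight combine so that `|k_z^n(w)|² dμ(w)` depends only
on `w - z`: `B_n` averages translates of `f` against a fixed probability density, positive off
finitely many circles. By Choquet–Deny (`choquetDeny`) its bounded fixed points are constant. Total
mass one is a Laguerre orthogonality computation. Harmonic functions are handled separately, by
Liouville. -/

/-! ### Bounded functions fixed by averaging. -/

/-- **Choquet–Deny**: a bounded function that is harmonic for an a.e. positive probability density
on an abelian group is invariant under all translations. -/
theorem choquetDeny {E : Type*} [AddCommGroup E] [MeasurableSpace E] [MeasurableAdd E]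
    {μ : Measure E} [μ.IsAddLeftInvariant] {φ : E → ℝ} (hφ : Integrable φ μ)
    (hφ1 : ∫ w, φ w ∂μ = 1) (hφpos : ∀ᵐ w ∂μ, 0 < φ w) {g : E → ℝ}
    (hg : AEStronglyMeasurable g μ) {C : ℝ} (hC : ∀ z, |g z| ≤ C)
    (hgφ : ∀ z, g z = ∫ w, g (z + w) * φ w ∂μ) (a z : E) : g (z + a) = g z := by
  have htrans : ∀ {v : E → ℝ}, AEStronglyMeasurable v μ → ∀ z,
      AEStronglyMeasurable (fun w => v (z + w)) μ := fun hv z =>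
    hv.comp_quasiMeasurePreserving (measurePreserving_add_left μ z).quasiMeasurePreserving
  suffices key : ∀ a z, g (z + a) ≤ g z by
    refine le_antisymm (key a z) ?_
    simpa using key (-a) (z + a)
  intro a
  -- If `sup h = M > 0`, then near a maximizing sequence `g` would gain about `M` at each of
  -- arbitrarily many steps `a`, against boundedness.
  set h : E → ℝ := fun z => g (z + a) - g z with hh
  have hhm : AEStronglyMeasurable h μ := by
    have : AEStronglyMeasurable (fun z => g (z + a)) μ := by
      simpa only [add_comm] using htrans hg a
    exact this.sub hg
  have hhb : ∀ z, |h z| ≤ 2 * C := fun z => by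
    have h1 := abs_le.1 (hC (z + a)); have h2 := abs_le.1 (hC z)
    exact abs_le.2 ⟨by simp only [hh]; linarith, by simp only [hh]; linarith⟩
  have hint : ∀ {v : E → ℝ} {D : ℝ}, AEStronglyMeasurable v μ → (∀ z, |v z| ≤ D) → ∀ z,
      Integrable (fun w => v (z + w) * φ w) μ := fun hv hD z =>
    hφ.bdd_mul (htrans hv z) (ae_of_all _ fun w => hD (z + w))
  have hhφ : ∀ z, h z = ∫ w, h (z + w) * φ w ∂μ := fun z => by
    have e : ∀ w, h (z + w) * φ w = g (z + a + w) * φ w - g (z + w) * φ w := fun w => by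
      simp only [hh, sub_mul, add_right_comm]
    simp_rw [e]
    rw [integral_sub (hint hg hC _) (hint hg hC _), ← hgφ, ← hgφ]
  have hbdd : BddAbove (Set.range h) := ⟨2 * C, by
    rintro _ ⟨z, rfl⟩; exact (abs_le.1 (hhb z)).2⟩
  set M := sSup (Set.range h) with hM
  have hle : ∀ z, h z ≤ M := fun z => le_csSup hbdd ⟨z, rfl⟩
  obtain ⟨u, -, hu, huM⟩ := exists_seq_tendsto_sSup (Set.range_nonempty h) hbdd
  choose ζ hζ using huM
  have hζM : Tendsto (fun k => h (ζ k)) atTop (𝓝 M) := by simpa only [hζ] using hu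
  set k : E → ℝ := fun z => M - h z with hk
  have hkm : AEStronglyMeasurable k μ := aestronglyMeasurable_const.sub hhm
  have hkb : ∀ z, |k z| ≤ |M| + 2 * C := fun z =>
    (abs_sub _ _).trans (add_le_add le_rfl (hhb z))
  have hkφ : ∀ z, k z = ∫ w, k (z + w) * φ w ∂μ := fun z => by
    simp only [hk, sub_mul]
    rw [integral_sub (hφ.const_mul M) (hint hhm hhb _), ← hhφ, integral_const_mul, hφ1, mul_one]
  have hk0 : Tendsto (fun i => k (ζ i)) atTop (𝓝 0) := by
    simpa [hk] using tendsto_const_nhds.sub hζM (a := M)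
  -- Since `k ≥ 0`, the `L¹` norm of the integrand is the average `k (ζ i)` itself.
  have hL1 : Tendsto (fun i => eLpNorm ((fun w => k (ζ i + w) * φ w) - fun _ => 0) 1 μ)
      atTop (𝓝 0) := by
    have e : ∀ i, eLpNorm ((fun w => k (ζ i + w) * φ w) - fun _ => 0) 1 μ
        = ENNReal.ofReal (k (ζ i)) := fun i => by
      rw [hkφ (ζ i), eLpNorm_one_eq_lintegral_enorm,
        ofReal_integral_eq_lintegral_ofReal (hint hkm hkb _)]
      · refine lintegral_congr_ae ?_
        filter_upwards [hφpos] with w hw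
        have := mul_nonneg (sub_nonneg.2 (hle (ζ i + w))) hw.le
        rw [Pi.sub_apply, sub_zero, Real.enorm_of_nonneg this]
      · filter_upwards [hφpos] with w hw
        exact mul_nonneg (sub_nonneg.2 (hle _)) hw.le
    simp_rw [e]
    simpa using ENNReal.tendsto_ofReal hk0
  obtain ⟨ns, hns, hae⟩ := (tendstoInMeasure_of_tendsto_eLpNorm one_ne_zero
    (fun i => (hint hkm hkb (ζ i)).aestronglyMeasurable) aestronglyMeasurable_const
      hL1).exists_seq_tendsto_ae
  have hkae : ∀ᵐ w ∂μ, Tendsto (fun i => k (ζ (ns i) + w)) atTop (𝓝 0) := by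
    filter_upwards [hae, hφpos] with w hw hw0
    simpa [hw0.ne'] using hw.mul_const (φ w)⁻¹
  -- Averaging once more upgrades convergence at almost every shift to every shift, in particular
  -- the multiples of `a`.
  have hshift : ∀ b, Tendsto (fun i => k (ζ (ns i) + b)) atTop (𝓝 0) := fun b => by
    have hφb : Integrable (fun w => φ (-b + w)) μ :=
      (measurePreserving_add_left μ (-b)).integrable_comp_of_integrable hφ
    have e : ∀ i, k (ζ (ns i) + b) = ∫ w, k (ζ (ns i) + w) * φ (-b + w) ∂μ := fun i => by
      rw [hkφ, ← integral_add_left_eq_self _ (-b)]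
      congr 1; ext w; congr 2; abel
    simp_rw [e]
    rw [← integral_zero E ℝ (μ := μ)]
    refine tendsto_integral_of_dominated_convergence (fun w => (|M| + 2 * C) * ‖φ (-b + w)‖)
      (fun i => (htrans hkm _).mul hφb.aestronglyMeasurable) (hφb.norm.const_mul _)
      (fun i => ae_of_all _ fun w => ?_) ?_
    · rw [norm_mul]
      exact mul_le_mul_of_nonneg_right (hkb _) (norm_nonneg _)
    · filter_upwards [hkae] with w hw
      simpa using hw.mul_const (φ (-b + w))
  have hmM : ∀ m : ℕ, (m : ℝ) * M ≤ 2 * C := fun m => by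
    have ht : Tendsto (fun i => ∑ j ∈ Finset.range m, h (ζ (ns i) + j • a)) atTop
        (𝓝 (∑ _j ∈ Finset.range m, M)) :=
      tendsto_finsetSum _ fun j _ => by
        simpa [hk] using tendsto_const_nhds.sub (hshift (j • a)) (a := M)
    have ht' : Tendsto (fun i => g (ζ (ns i) + m • a) - g (ζ (ns i))) atTop (𝓝 (m * M)) := by
      convert ht using 2 with i
      · have := Finset.sum_range_sub (fun j : ℕ => g (ζ (ns i) + j • a)) m
        simp only [zero_smul, add_zero] at this
        rw [← this]
        exact Finset.sum_congr rfl fun j _ => by simp [hh, add_smul, add_assoc]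
      · simp
    refine le_of_tendsto' ht' fun i => ?_
    have h1 := abs_le.1 (hC (ζ (ns i) + m • a)); have h2 := abs_le.1 (hC (ζ (ns i)))
    linarith
  have hM0 : M ≤ 0 := by
    by_contra! hpos
    obtain ⟨m, hm⟩ := exists_nat_gt (2 * C / M)
    rw [div_lt_iff₀ hpos] at hm
    exact absurd (hmM m) (not_le.2 hm)
  intro z
  exact sub_nonpos.1 ((hle z).trans hM0)

/-! ### Laguerre polynomials against the Gaussian. -/

/-- The `n`-th difference at `0` of `m ↦ C(m+j-1, j)`, of degree `j < n`, vanishes. Its `m = 0` term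
gives the right side; the others give the sum, up to sign. -/
theorem sum_neg_one_pow_mul_choose_mul_choose {j n : ℕ} (hj : j < n) :
    ∑ k ∈ Finset.range n, (-1 : ℤ) ^ k * n.choose (k + 1) * (j + k).choose j
      = if j = 0 then 1 else 0 := by
  have hΔ : (fwdDiff 1)^[n] (fun m : ℕ => ((m + (j - 1)).choose j : ℤ)) 0 = 0 := by
    obtain ⟨d, rfl⟩ := Nat.exists_eq_add_of_lt hj
    rw [fwdDiff_iter_comp_add 1 (fun m : ℕ => (m.choose j : ℤ)), show j + d + 1 = d + 1 + j by ring,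
      Function.iterate_add_apply]
    have h1 := fwdDiff_iter_choose 0 j
    rw [add_zero] at h1
    rw [h1]
    simp only [Nat.choose_zero_right, Nat.cast_one, Function.iterate_succ_apply, fwdDiff_const]
    simp [fwdDiff_iter_eq_sum_shift]
  rw [fwdDiff_iter_eq_sum_shift, Finset.sum_range_succ'] at hΔ
  have hs : ∑ k ∈ Finset.range n, ((-1 : ℤ) ^ (n - (k + 1)) * n.choose (k + 1)) •
      ((0 + (k + 1) • 1 + (j - 1)).choose j : ℤ)
      = - (-1) ^ n * ∑ k ∈ Finset.range n, (-1 : ℤ) ^ k * n.choose (k + 1) * (j + k).choose j := by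
    rw [Finset.mul_sum]
    refine Finset.sum_congr rfl fun k hk => ?_
    have hk := Finset.mem_range.1 hk
    have e1 : (-1 : ℤ) ^ n = (-1) ^ (n - (k + 1)) * (-1) ^ (k + 1) := by
      rw [← pow_add, Nat.sub_add_cancel hk]
    have e2 : (0 + (k + 1) • 1 + (j - 1)).choose j = (j + k).choose j := by
      rcases j with _ | j
      · simp
      · congr 1; simp; ring
    have e3 : ((-1 : ℤ) ^ k) * (-1) ^ k = 1 := by rw [← mul_pow]; simp
    rw [e2, e1, pow_succ, smul_eq_mul]
    linear_combination (- (-1 : ℤ) ^ (n - (k + 1)) * n.choose (k + 1) * (j + k).choose j) * e3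
  rw [hs] at hΔ
  have e0 : ((0 + 0 • 1 + (j - 1)).choose j : ℤ) = if j = 0 then 1 else 0 := by
    rcases j with _ | j <;> simp
  rw [e0] at hΔ
  have hn : ((-1 : ℤ) ^ n) * (-1) ^ n = 1 := by rw [← mul_pow]; simp
  simp only [Nat.sub_zero, Nat.choose_zero_right, Nat.cast_one, mul_one, smul_eq_mul] at hΔ
  linear_combination (-(-1 : ℤ) ^ n) * hΔ + ((if j = 0 then 1 else 0) -
    ∑ k ∈ Finset.range n, (-1 : ℤ) ^ k * n.choose (k + 1) * (j + k).choose j) * hn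

theorem integral_norm_sq_pow_mul_exp (m : ℕ) :
    ∫ w : ℂ, (‖w‖ ^ 2) ^ m * Real.exp (-‖w‖ ^ 2) = Real.pi * m.factorial := by
  have := Complex.integral_rpow_mul_exp_neg_rpow (p := 2) (q := (2 * m : ℕ)) (by norm_num)
    (by linarith [(Nat.cast_nonneg (2 * m) : (0 : ℝ) ≤ _)])
  simp only [Real.rpow_natCast, Real.rpow_two, pow_mul] at this
  rw [this, show (((2 * m : ℕ) : ℝ) + 2) / 2 = m + 1 by push_cast; ring,
    Real.Gamma_nat_eq_factorial]
  ring

theorem integrable_norm_sq_pow_mul_exp (m : ℕ) :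
    Integrable fun w : ℂ => (‖w‖ ^ 2) ^ m * Real.exp (-‖w‖ ^ 2) := by
  -- A non-integrable function has integral `0` by convention, but this value is positive.
  by_contra h
  have h1 := integral_norm_sq_pow_mul_exp m
  rw [integral_undef h] at h1
  exact (mul_pos Real.pi_pos (Nat.cast_pos.2 m.factorial_pos)).ne h1

theorem laguerre_zero (β k : ℕ) : laguerre β k 0 = ((k + β).choose k : ℝ) := by
  rw [laguerre, Finset.sum_range_succ']
  simp

theorem laguerre_sq (β k : ℕ) (x : ℝ) : laguerre β k x ^ 2 =
    ∑ i ∈ Finset.range (k + 1), ∑ j ∈ Finset.range (k + 1),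
      ((-1) ^ i * (k + β).choose (k - i) / i.factorial *
        ((-1) ^ j * (k + β).choose (k - j) / j.factorial)) * x ^ (i + j) := by
  rw [sq, laguerre, Finset.sum_mul_sum]
  refine Finset.sum_congr rfl fun i _ => Finset.sum_congr rfl fun j _ => ?_
  rw [neg_pow x i, neg_pow x j, pow_add]
  ring

theorem integrable_laguerre_sq_mul_exp (β k : ℕ) :
    Integrable fun w : ℂ => laguerre β k (‖w‖ ^ 2) ^ 2 * Real.exp (-‖w‖ ^ 2) := by
  simp_rw [laguerre_sq, Finset.sum_mul, mul_assoc _ ((‖_‖ ^ 2) ^ _)]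
  exact integrable_finsetSum _ fun i _ => integrable_finsetSum _ fun j _ =>
    (integrable_norm_sq_pow_mul_exp _).const_mul _

/-- `L^1_k` is orthogonal to `x^i` for `1 ≤ i ≤ k` under `e^{-x} dx`, so expanding one factor leaves
only its constant term `k + 1`. -/
theorem integral_laguerre_one_sq_mul_exp (k : ℕ) :
    ∫ w : ℂ, laguerre 1 k (‖w‖ ^ 2) ^ 2 * Real.exp (-‖w‖ ^ 2) = Real.pi * (k + 1) := by
  simp_rw [laguerre_sq, Finset.sum_mul, mul_assoc _ ((‖_‖ ^ 2) ^ _)]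
  rw [integral_finsetSum _ fun i _ => integrable_finsetSum _ fun j _ =>
    (integrable_norm_sq_pow_mul_exp _).const_mul _]
  have inner : ∀ i ∈ Finset.range (k + 1),
      ∫ w : ℂ, ∑ j ∈ Finset.range (k + 1),
        ((-1) ^ i * (k + 1).choose (k - i) / i.factorial *
        ((-1) ^ j * (k + 1).choose (k - j) / j.factorial) : ℝ) *
          ((‖w‖ ^ 2) ^ (i + j) * Real.exp (-‖w‖ ^ 2))
      = Real.pi * ((-1) ^ i * (k + 1).choose (k - i)) * (if i = 0 then 1 else 0) := by
    intro i hi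
    rw [integral_finsetSum _ fun j _ => (integrable_norm_sq_pow_mul_exp _).const_mul _]
    simp_rw [integral_const_mul, integral_norm_sq_pow_mul_exp]
    have h := congrArg (Int.cast : ℤ → ℝ)
      (sum_neg_one_pow_mul_choose_mul_choose (Finset.mem_range.1 hi))
    push_cast at h
    rw [← h, Finset.mul_sum]
    refine Finset.sum_congr rfl fun j hj => ?_
    have hj' : j ≤ k := Nat.lt_succ_iff.1 (Finset.mem_range.1 hj)
    rw [Nat.cast_add_choose, ← Nat.choose_symm_of_eq_add (show k + 1 = (k - j) + (j + 1) by omega)]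
    have := Nat.cast_ne_zero (R := ℝ).2 i.factorial_ne_zero
    have := Nat.cast_ne_zero (R := ℝ).2 j.factorial_ne_zero
    field_simp
  rw [Finset.sum_congr rfl inner]
  simp

theorem ae_laguerre_norm_sq_ne_zero (β k : ℕ) :
    ∀ᵐ w : ℂ, laguerre β k (‖w‖ ^ 2) ≠ 0 := by
  let P : Polynomial ℝ := ∑ j ∈ Finset.range (k + 1),
    Polynomial.C (((k + β).choose (k - j) : ℝ) / j.factorial) * (-Polynomial.X) ^ j
  have hP : ∀ x, P.eval x = laguerre β k x := fun x => by
    simp only [P, laguerre, Polynomial.eval_finsetSum, Polynomial.eval_mul, Polynomial.eval_C,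
      Polynomial.eval_pow, Polynomial.eval_neg, Polynomial.eval_X]
    exact Finset.sum_congr rfl fun j _ => by ring
  have hP0 : P ≠ 0 := by
    intro h
    have h0 := hP 0
    rw [h, laguerre_zero, Polynomial.eval_zero] at h0
    exact (Nat.choose_pos (Nat.le_add_right k β)).ne (by exact_mod_cast h0)
  -- A negative root only contributes the harmless sphere of radius `√r = 0`.
  have hnull : volume (⋃ r ∈ P.roots.toFinset, Metric.sphere (0 : ℂ) (Real.sqrt r)) = 0 :=
    (measure_biUnion_null_iff P.roots.toFinset.countable_toSet).2 fun r _ =>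
      Measure.addHaar_sphere _ _ _
  refine measure_mono_null (fun w hw => ?_) hnull
  have hw : laguerre β k (‖w‖ ^ 2) = 0 := not_not.1 hw
  refine Set.mem_biUnion (x := ‖w‖ ^ 2) ?_ (by simp)
  simpa [hP0] using (hP _).trans hw

/-! ### The Berezin transform as an average of translates. -/

/-- The density `|k_0^n|² e^{-|w|²} / π`. -/
noncomputable def berezinDensity (n : ℕ) (w : ℂ) : ℝ :=
  laguerre 1 (n - 1) (‖w‖ ^ 2) ^ 2 * Real.exp (-‖w‖ ^ 2) / (n * Real.pi)

theorem integrable_berezinDensity (n : ℕ) : Integrable (berezinDensity n) :=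
  (integrable_laguerre_sq_mul_exp 1 (n - 1)).div_const _

theorem integral_berezinDensity {n : ℕ} (hn : 1 ≤ n) : ∫ w, berezinDensity n w = 1 := by
  obtain ⟨k, rfl⟩ := Nat.exists_eq_add_of_le' hn
  simp only [berezinDensity]
  rw [integral_div, Nat.add_sub_cancel, integral_laguerre_one_sq_mul_exp]
  have := Real.pi_ne_zero
  push_cast
  field_simp

theorem ae_berezinDensity_pos {n : ℕ} (hn : 1 ≤ n) : ∀ᵐ w, 0 < berezinDensity n w := by
  filter_upwards [ae_laguerre_norm_sq_ne_zero 1 (n - 1)] with w hw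
  have : (0 : ℝ) < n := by exact_mod_cast hn
  have := Real.pi_pos
  unfold berezinDensity
  positivity

theorem berezinDensity_nonneg (n : ℕ) (w : ℂ) : 0 ≤ berezinDensity n w := by
  have := Real.pi_pos
  unfold berezinDensity
  positivity

theorem kernel_self {n : ℕ} (hn : 1 ≤ n) (z : ℂ) :
    kernel n z z = ((n * Real.exp (‖z‖ ^ 2) : ℝ) : ℂ) := by
  obtain ⟨k, rfl⟩ := Nat.exists_eq_add_of_le' hn
  rw [kernel, Complex.mul_conj, Complex.normSq_eq_norm_sq]
  simp [laguerre_zero]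

theorem normalizedKernel_mul_conj {n : ℕ} (hn : 1 ≤ n) (z w : ℂ) :
    normalizedKernel n z w * conj (normalizedKernel n z w) * (Real.exp (-‖w‖ ^ 2) / Real.pi : ℝ)
      = berezinDensity n (w - z) := by
  have hn0 : (0 : ℝ) < n := by exact_mod_cast hn
  rw [Complex.mul_conj, ← Complex.ofReal_mul, Complex.ofReal_inj, normalizedKernel, kernel_self hn,
    Complex.normSq_div, Complex.ofReal_re, Complex.normSq_ofReal,
    Real.mul_self_sqrt (by positivity), kernel, Complex.normSq_mul, Complex.normSq_ofReal,
    Complex.normSq_eq_norm_sq (Complex.exp _), Complex.norm_exp, berezinDensity]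
  have hexp : Real.exp (-‖w - z‖ ^ 2) =
      Real.exp ((w * conj z).re) ^ 2 * Real.exp (-‖w‖ ^ 2) / Real.exp (‖z‖ ^ 2) := by
    rw [← Real.exp_nat_mul, ← Real.exp_add, ← Real.exp_sub]
    congr 1
    simp only [← Complex.normSq_eq_norm_sq, Complex.normSq_sub]
    push_cast
    ring
  rw [hexp]
  have := Real.pi_ne_zero
  field_simp

theorem berezin_eq_integral {n : ℕ} (hn : 1 ≤ n) (f : ℂ → ℂ) (z : ℂ) :
    berezin n f z = ∫ w, f (z + w) * berezinDensity n w := by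
  have hm : Measurable fun w : ℂ => Real.exp (-‖w‖ ^ 2) / Real.pi := by fun_prop
  rw [berezin, innerGaussian, gaussian, integral_withDensity_eq_integral_toReal_smul
    hm.ennreal_ofReal (ae_of_all _ fun _ => ENNReal.ofReal_lt_top),
    ← integral_add_left_eq_self _ z]
  refine integral_congr_ae (ae_of_all _ fun w => ?_)
  have h := normalizedKernel_mul_conj hn z (z + w)
  rw [add_sub_cancel_left] at h
  have hp : 0 ≤ Real.exp (-‖z + w‖ ^ 2) / Real.pi := by have := Real.pi_pos; positivity
  simp only [ENNReal.toReal_ofReal hp, Complex.real_smul, ← h]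
  ring

theorem berezin_const {n : ℕ} (hn : 1 ≤ n) (c z : ℂ) : berezin n (fun _ => c) z = c := by
  rw [berezin_eq_integral hn, integral_const_mul, integral_complex_ofReal,
    integral_berezinDensity hn, Complex.ofReal_one, mul_one]

theorem berezin_congr_ae {n : ℕ} (hn : 1 ≤ n) {f g : ℂ → ℂ} (h : f =ᵐ[volume] g) :
    berezin n f = berezin n g := by
  ext z
  rw [berezin_eq_integral hn, berezin_eq_integral hn]
  refine integral_congr_ae ?_
  filter_upwards [(measurePreserving_add_left volume z).quasiMeasurePreserving.ae_eq_comp h]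
    with w hw
  exact congrArg (· * (berezinDensity n w : ℂ)) hw

theorem norm_berezin_le {n : ℕ} (hn : 1 ≤ n) {f : ℂ → ℂ} {C : ℝ} (hC : ∀ᵐ w, ‖f w‖ ≤ C) (z : ℂ) :
    ‖berezin n f z‖ ≤ C := by
  rw [berezin_eq_integral hn]
  refine (norm_integral_le_of_norm_le ((integrable_berezinDensity n).const_mul C) ?_).trans
    (by rw [integral_const_mul, integral_berezinDensity hn, mul_one])
  filter_upwards [(measurePreserving_add_left volume z).quasiMeasurePreserving.ae hC] with w hw
  rw [norm_mul, Complex.norm_real, Real.norm_of_nonneg (berezinDensity_nonneg n w)]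
  exact mul_le_mul_of_nonneg_right hw (berezinDensity_nonneg n w)

/-- A bounded function fixed by the Berezin transform is constant. -/
theorem eq_const_of_berezin_eq {n : ℕ} (hn : 1 ≤ n) {g : ℂ → ℂ}
    (hg : AEStronglyMeasurable g volume) {C : ℝ} (hC : ∀ z, ‖g z‖ ≤ C)
    (hB : berezin n g = g) (z : ℂ) : g z = g 0 := by
  have hint : ∀ z, Integrable fun w => g (z + w) * (berezinDensity n w : ℂ) := fun z =>
    (integrable_berezinDensity n).ofReal.bdd_mul
      (hg.comp_quasiMeasurePreserving (measurePreserving_add_left volume z).quasiMeasurePreserving)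
      (ae_of_all _ fun w => hC (z + w))
  have hfix : ∀ z, g z = ∫ w, g (z + w) * (berezinDensity n w : ℂ) := fun z => by
    rw [← berezin_eq_integral hn, hB]
  have hre := choquetDeny (integrable_berezinDensity n) (integral_berezinDensity hn)
    (ae_berezinDensity_pos hn) (g := fun z => (g z).re)
    (Complex.continuous_re.comp_aestronglyMeasurable hg)
    (fun z => (Complex.abs_re_le_norm _).trans (hC z))
    (fun z => by
      conv_lhs => rw [hfix z]
      refine (Complex.reCLM.integral_comp_comm (hint z)).symm.trans ?_
      simp) z 0
  have him := choquetDeny (integrable_berezinDensity n) (integral_berezinDensity hn)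
    (ae_berezinDensity_pos hn) (g := fun z => (g z).im)
    (Complex.continuous_im.comp_aestronglyMeasurable hg)
    (fun z => (Complex.abs_im_le_norm _).trans (hC z))
    (fun z => by
      conv_lhs => rw [hfix z]
      refine (Complex.imCLM.integral_comp_comm (hint z)).symm.trans ?_
      simp) z 0
  rw [zero_add] at hre him
  exact Complex.ext hre him

end PolyFock

/-! ### The equivalences. -/

open PolyFock in
/-- Elements of `L^∞(ℂ)` are given by representatives `f`, so equalities are almost everywhere, and
`f` is harmonic when it agrees almost everywhere with a harmonic function on `ℂ`. -/
theorem corollary2 (n : ℕ) (hn : 1 ≤ n) (f : ℂ → ℂ)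
    (hf : MeasureTheory.MemLp f ⊤ (MeasureTheory.volume : MeasureTheory.Measure ℂ)) :
    List.TFAE
      [PolyFock.berezin n f =ᵐ[MeasureTheory.volume] f,
       ∃ u : ℂ → ℂ, InnerProductSpace.HarmonicOnNhd u Set.univ ∧ f =ᵐ[MeasureTheory.volume] u,
       ∃ c : ℂ, f =ᵐ[MeasureTheory.volume] fun _ => c] := by
  obtain ⟨C, hC⟩ : ∃ C : ℝ, ∀ᵐ w, ‖f w‖ ≤ C := by
    refine ⟨(eLpNormEssSup f volume).toReal, ?_⟩
    filter_upwards [ae_le_eLpNormEssSup (f := f) (μ := volume)] with w hw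
    rw [← toReal_enorm]
    exact ENNReal.toReal_mono (eLpNorm_exponent_top (f := f) ▸ hf.2.ne) hw
  -- The representative `B_n f` is bounded and fixed everywhere, not just almost everywhere.
  tfae_have 1 → 3 := fun h =>
    ⟨berezin n f 0, h.symm.trans (ae_of_all _ (eq_const_of_berezin_eq hn (hf.1.congr h.symm)
      (norm_berezin_le hn hC) (berezin_congr_ae hn h)))⟩
  tfae_have 3 → 2 := fun ⟨c, hc⟩ =>
    ⟨fun _ => c, fun z _ => analyticAt_const.harmonicAt, hc⟩
  tfae_have 2 → 3 := by
    rintro ⟨u, hu, hfu⟩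
    have hcont : Continuous u := continuousOn_univ.1 hu.contDiffOn.continuousOn
    -- A set of full measure is dense, so continuity extends the essential bound to every point.
    have hdense : Dense {z | ‖u z‖ ≤ C} := Measure.dense_of_ae (μ := volume) (by
      filter_upwards [hC, hfu] with w hw hfw
      exact hfw ▸ hw)
    have hbound : ∀ z, ‖u z‖ ≤ C := fun z =>
      (isClosed_le hcont.norm continuous_const).closure_subset (hdense z)
    refine ⟨u 0, hfu.trans (ae_of_all _ fun z => ?_)⟩
    exact InnerProductSpace.bounded_harmonic_on_complex_plane_is_constant u hu
      (isBounded_iff_forall_norm_le.2 ⟨C, Set.forall_mem_range.2 hbound⟩) z 0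
  tfae_have 3 → 1 := fun ⟨c, hc⟩ => by
    rw [berezin_congr_ae hn hc]
    exact EventuallyEq.trans (ae_of_all _ (berezin_const hn c)) hc.symm
  tfae_finish
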